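/- Let $A$ be an associative algebra (not necessarily with unit) of arbitrary, possibly infinite, dimension over a field $F$, and let a finite soluble group $G$ of order $n$ act on $A$ by $F$-algebra automorphisms. Suppose that the characteristic of $F$ does not divide $n$. Let $A^G=\{a\in A \mid a^g=a \text{ for all } g\in G\}$ be the fixed-point subalgebra. For a subspace $I$ of an algebra and an integer $d\ge 1$, $I^d$ denotes the span of all products of $d$ elements of $I$, and $I$ is said to be nilpotent of index $d$ if $I^d=0$. There are functions $f:\mathbb N^2\to\mathbb N$ and $c:\mathbb N^3\to\mathbb N$, independent of $F$, $A$, $G$ and the action, such that the following holds: if $A^G$ has a two-sided ideal $I$ that is nilpotent of index $d$ and has finite codimension $m=\dim_F A^G/I$ in $A^G$, then $A$ has a two-sided ideal $H$ that is nilpotent of index at most $f(n,d)$ and has finite codimension $\dim_F A/H\le c(n,d,m)$ in $A$. -/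

import Mathlib

/-!
Associative algebras are not assumed to have a unit: an associative algebra over a field `F` is a
`NonUnitalRing A` with `[Module F A] [IsScalarTower F A A] [SMulCommClass F A A]`.
-/

namespace AlmostNilpotent

/-- A linear action `ρ` of a group `G` on an associative algebra `A` is an action by algebra
automorphisms if every `ρ g` is multiplicative. -/
def ActsByAutomorphisms {F A G : Type*} [Field F] [NonUnitalRing A] [Module F A] [Group G]
    (ρ : Representation F G A) : Prop :=
  ∀ (g : G) (x y : A), ρ g (x * y) = ρ g x * ρ g y

/-- The fixed-point subalgebra `A^G`. -/
def fixedSubalgebra {F A G : Type*} [Field F] [NonUnitalRing A] [Module F A] [Group G]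
    (ρ : Representation F G A) (hρ : ActsByAutomorphisms ρ) : NonUnitalSubalgebra F A where
  carrier := {a | ∀ g : G, ρ g a = a}
  add_mem' := fun {a b} ha hb g => by rw [map_add, ha g, hb g]
  zero_mem' := fun g => map_zero (ρ g)
  mul_mem' := fun {a b} ha hb g => by rw [hρ g a b, ha g, hb g]
  smul_mem' := fun c a ha g => by rw [map_smul, ha g]

/-- A subspace `I` of the algebra `B` is a two-sided ideal of `B`. -/
def IsTwoSidedIdeal {F B : Type*} [Field F] [NonUnitalRing B] [Module F B]
    (I : Submodule F B) : Prop :=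
  ∀ b : B, ∀ x ∈ I, b * x ∈ I ∧ x * b ∈ I

/-- For subspaces `I`, `J` of `B`, the subspace `IJ` spanned by all products `x * y` with `x ∈ I`
and `y ∈ J`. -/
def subspaceMul {F B : Type*} [Field F] [NonUnitalRing B] [Module F B]
    (I J : Submodule F B) : Submodule F B :=
  Submodule.span F {z | ∃ x ∈ I, ∃ y ∈ J, z = x * y}

/-- `subspacePow I k` is the `(k + 1)`-fold product `I ⋯ I`, so that the exponents start at 1
(there is no empty product in an algebra without unit). -/
def subspacePow {F B : Type*} [Field F] [NonUnitalRing B] [Module F B]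
    (I : Submodule F B) : ℕ → Submodule F B
  | 0 => I
  | k + 1 => subspaceMul (subspacePow I k) I

/-- `I` is nilpotent of index `d`, that is, `d ≥ 1` and `I ^ d = 0`. -/
def IsNilpotentOfIndex {F B : Type*} [Field F] [NonUnitalRing B] [Module F B]
    (I : Submodule F B) (d : ℕ) : Prop :=
  1 ≤ d ∧ subspacePow I (d - 1) = ⊥

/-- `I` has finite codimension `m` in `B`, that is, `B / I` is finite-dimensional of
dimension `m`. -/
def HasCodimension {F B : Type*} [Field F] [NonUnitalRing B] [Module F B]
    (I : Submodule F B) (m : ℕ) : Prop :=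
  FiniteDimensional F (B ⧸ I) ∧ Module.finrank F (B ⧸ I) = m

end AlmostNilpotent

/-! Adjoining a unit raises the codimension in the fixed points by at most one, so `A` may be taken
unital. Solubility reduces the problem to cyclic groups: for `N` normal in `G`, the quotient `G/N`
acts on `A^N` with fixed points `A^G`, so a nilpotent ideal of finite codimension passes from `A^G`
to `A^N` and then to `A`. For a cyclic group, extending scalars by a primitive root of unity makes
the algebra a sum of eigenspaces of a generator: it is graded by a finite group, and its identity
component is the extended fixed-point algebra.

The graded case, `exists_nilpotent_ideal_of_graded`, carries the theorem. Since `A_g A_{g⁻¹} ≤ A_1`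
and `A_1/I` is finite-dimensional, there are finitely many `u_i` in `A_{g⁻¹}` with `A_g A_{g⁻¹} ≤ I
+ ∑ A_g u_i`. Those `x` in `A_g` with every `u_i x` in `I` form a subspace `K_g` of finite
codimension, and `K_g A_{g⁻¹} K_g` lies in `J = A I A`. In a product of `n² + 1` letters from the
`K_g`, with homogeneous factors in between, two letters share both their degree `g` and the degree
of the prefix before them. The segment strictly between them has degree `g⁻¹`, so the product lies
in `J`. Hence the ideal generated by the `K_g` is nilpotent modulo `J`, and the same count applied
to powers of `I` shows that `J` is nilpotent. -/

namespace AlmostNilpotent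

/-! ### Codimension bounds for subspaces. -/

section Codimension

variable {F M N : Type*} [Field F] [AddCommGroup M] [Module F M] [AddCommGroup N] [Module F N]

/-- `I` has codimension at most `k` in `M`. -/
def CodimLE (I : Submodule F M) (k : ℕ) : Prop :=
  Module.Finite F (M ⧸ I) ∧ Module.finrank F (M ⧸ I) ≤ k

theorem CodimLE.of_ker_le {V : Type*} [AddCommGroup V] [Module F V] [Module.Finite F V]
    {I : Submodule F M} {k : ℕ} (φ : M →ₗ[F] V) (hφ : LinearMap.ker φ ≤ I)
    (hk : Module.finrank F V ≤ k) : CodimLE I k := by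
  have hfin : Module.Finite F (M ⧸ LinearMap.ker φ) :=
    Module.Finite.equiv φ.quotKerEquivRange.symm
  have hs : Function.Surjective (Submodule.factor hφ) := Submodule.factor_surjective hφ
  refine ⟨Module.Finite.of_surjective _ hs, (LinearMap.finrank_le_finrank_of_surjective hs).trans ?_⟩
  rw [φ.quotKerEquivRange.finrank_eq]
  exact (Submodule.finrank_le _).trans hk

theorem CodimLE.mono {I J : Submodule F M} {k l : ℕ} (h : CodimLE I k) (hIJ : I ≤ J)
    (hkl : k ≤ l) : CodimLE J l := by
  have := h.1
  exact CodimLE.of_ker_le I.mkQ (by simpa using hIJ) (h.2.trans hkl)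

theorem CodimLE.comap {I : Submodule F M} {k : ℕ} (h : CodimLE I k) (φ : N →ₗ[F] M) :
    CodimLE (I.comap φ) k := by
  have := h.1
  exact CodimLE.of_ker_le (I.mkQ ∘ₗ φ) (by simp [LinearMap.ker_comp]) h.2

theorem CodimLE.iInf {ι : Type*} [Fintype ι] {I : ι → Submodule F M} {k : ℕ}
    (h : ∀ i, CodimLE (I i) k) : CodimLE (⨅ i, I i) (Fintype.card ι * k) := by
  have := fun i => (h i).1
  refine CodimLE.of_ker_le (LinearMap.pi fun i => (I i).mkQ) (by simp [LinearMap.ker_pi]) ?_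
  rw [Module.finrank_pi_fintype]
  exact (Finset.sum_le_card_nsmul _ _ k fun i _ => (h i).2).trans (by simp)

/-- The product of the quotients `P i / (P i ∩ I)` maps onto `M / I`, because the `P i` span `M`. -/
theorem CodimLE.of_iSup_eq_top {ι : Type*} [Fintype ι] {P : ι → Submodule F M}
    (hP : ⨆ i, P i = ⊤) {I : Submodule F M} {k : ℕ}
    (h : ∀ i, CodimLE (I.comap (P i).subtype) k) : CodimLE I (Fintype.card ι * k) := by
  classical
  have := fun i => (h i).1
  let ψ : (∀ i, P i ⧸ I.comap (P i).subtype) →ₗ[F] M ⧸ I :=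
    ∑ i, (Submodule.mapQ _ I (P i).subtype le_rfl) ∘ₗ LinearMap.proj i
  have hψ : Function.Surjective ψ := by
    rw [← LinearMap.range_eq_top, eq_top_iff, ← Submodule.range_mkQ I, LinearMap.range_eq_map,
      ← hP, Submodule.map_iSup, iSup_le_iff]
    rintro i _ ⟨x, hx, rfl⟩
    refine ⟨Pi.single i (Submodule.Quotient.mk ⟨x, hx⟩), ?_⟩
    simp only [ψ, LinearMap.sum_apply, LinearMap.comp_apply, LinearMap.proj_apply]
    rw [Finset.sum_eq_single i]
    · simp
    · intro j _ hj
      simp [Pi.single_eq_of_ne hj]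
    · simp
  refine ⟨Module.Finite.of_surjective ψ hψ,
    (LinearMap.finrank_le_finrank_of_surjective hψ).trans ?_⟩
  rw [Module.finrank_pi_fintype]
  exact (Finset.sum_le_card_nsmul _ _ k fun i _ => (h i).2).trans (by simp)

theorem CodimLE.exists_sup_eq_top {I : Submodule F M} {k : ℕ} (h : CodimLE I k) :
    ∃ W : Submodule F M, Module.Finite F W ∧ Module.finrank F W ≤ k ∧ I ⊔ W = ⊤ := by
  obtain ⟨W, hW⟩ := I.exists_isCompl
  have := h.1
  have e := Submodule.quotientEquivOfIsCompl I W hW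
  exact ⟨W, Module.Finite.equiv e, e.finrank_eq ▸ h.2, hW.sup_eq_top⟩

end Codimension

/-! ### Algebras graded by a finite group. -/

section Graded

variable {F A Γ : Type*} [Field F] [Ring A] [Algebra F A] [Group Γ]
  {𝒜 : Γ → Submodule F A}

theorem top_mul_top_eq : (⊤ : Submodule F A) * ⊤ = ⊤ :=
  top_le_iff.1 fun x _ => by
    simpa using Submodule.mul_mem_mul (Submodule.mem_top (R := F) (x := x))
      (Submodule.mem_top (x := (1 : A)))

theorem pow_top_mul_mul_top (K : Submodule F A) (N : ℕ) :
    (⊤ * K * ⊤) ^ N * ⊤ = ⊤ * (K * ⊤) ^ N := by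
  have htop : (⊤ : Submodule F A) * ⊤ = ⊤ := top_mul_top_eq
  induction N with
  | zero => simp
  | succ N ih =>
    calc (⊤ * K * ⊤) ^ (N + 1) * ⊤ = (⊤ * K * ⊤) ^ N * (⊤ * K * (⊤ * ⊤)) := by
          rw [pow_succ]; simp only [mul_assoc]
      _ = ((⊤ * K * ⊤) ^ N * ⊤) * (K * ⊤) := by rw [htop]; simp only [mul_assoc]
      _ = ⊤ * (K * ⊤) ^ (N + 1) := by rw [ih, pow_succ, mul_assoc]

theorem le_mul_top (P : Submodule F A) : P ≤ P * ⊤ := by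
  intro x hx
  simpa using Submodule.mul_mem_mul hx (Submodule.mem_top (x := (1 : A)))

theorem le_top_mul (P : Submodule F A) : P ≤ ⊤ * P := by
  intro x hx
  simpa using Submodule.mul_mem_mul (Submodule.mem_top (x := (1 : A))) hx

/-- Products of length `N` of elements of the pieces `K g`, sorted by the set of pairs
(degree of the prefix, degree of the letter) that occur along the product. -/
theorem pow_le_sup_iSup (hmul : ∀ g h, 𝒜 g * 𝒜 h ≤ 𝒜 (g * h)) (h1 : (1 : A) ∈ 𝒜 1)
    (htop : ⨆ g, 𝒜 g = ⊤) {K : Γ → Submodule F A} (hK : ∀ g, K g ≤ 𝒜 g)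
    {J : Submodule F A} (hJl : ⊤ * J ≤ J) (hJr : J * ⊤ ≤ J)
    (hKJ : ∀ g, K g * 𝒜 g⁻¹ * K g ≤ J) (N : ℕ) :
    ((⨆ g, K g) * ⊤) ^ N ≤ J ⊔ ⨆ (V : Finset (Γ × Γ)) (_ : V.card = N) (s : Γ),
      𝒜 s ⊓ ⨅ p ∈ V, 𝒜 p.1 * K p.2 * 𝒜 ((p.1 * p.2)⁻¹ * s) := by
  classical
  induction N with
  | zero =>
    refine le_sup_of_le_right (le_iSup₂_of_le ∅ rfl (le_iSup_of_le 1 ?_))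
    rw [pow_zero, Submodule.one_le]
    simpa using h1
  | succ N ih =>
    rw [pow_succ]
    refine (mul_le_mul_left ih _).trans ?_
    rw [Submodule.sup_mul]
    refine sup_le (le_sup_of_le_left ((mul_le_mul_right le_top _).trans hJr)) ?_
    -- The trailing arbitrary factor is split into homogeneous parts, so that the longer prefix
    -- again has a definite degree.
    conv_lhs => rw [← htop]
    simp only [Submodule.iSup_mul, Submodule.mul_iSup, iSup_le_iff]
    intro h g V hV s
    set R := 𝒜 s ⊓ ⨅ p ∈ V, 𝒜 p.1 * K p.2 * 𝒜 ((p.1 * p.2)⁻¹ * s) with hR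
    by_cases hp : (s, g) ∈ V
    -- Repeated pair: the segment between the two letters of degree `g` has degree `(s * g)⁻¹ * s =
    -- g⁻¹`, so `hKJ` applies.
    · refine le_sup_of_le_left ?_
      have hle : R ≤ 𝒜 s * K g * 𝒜 ((s * g)⁻¹ * s) := inf_le_right.trans (iInf₂_le (s, g) hp)
      have hs : (s * g)⁻¹ * s = g⁻¹ := by group
      rw [hs] at hle
      calc R * (K g * 𝒜 h) ≤ (𝒜 s * K g * 𝒜 g⁻¹) * (K g * 𝒜 h) := mul_le_mul_left hle _
        _ = 𝒜 s * (K g * 𝒜 g⁻¹ * K g) * 𝒜 h := by simp only [mul_assoc]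
        _ ≤ ⊤ * J * ⊤ := mul_le_mul' (mul_le_mul' le_top (hKJ g)) le_top
        _ ≤ J := (mul_le_mul_left hJl _).trans hJr
    -- New pair: it is recorded in `V`, and for the older pairs the tail absorbs the new factors.
    · refine le_sup_of_le_right (le_iSup₂_of_le (insert (s, g) V) (by simp [hp, hV])
        (le_iSup_of_le (s * g * h) (le_inf ?_ (le_iInf₂ ?_))))
      · calc R * (K g * 𝒜 h) ≤ 𝒜 s * (𝒜 g * 𝒜 h) :=
              mul_le_mul' inf_le_left (mul_le_mul_left (hK g) _)
          _ ≤ 𝒜 (s * g * h) := by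
              rw [← mul_assoc]
              exact (mul_le_mul_left (hmul s g) _).trans (hmul _ _)
      · intro p hpV
        rcases Finset.mem_insert.1 hpV with rfl | hpV
        · have e : (s * g)⁻¹ * (s * g * h) = h := by group
          simp only [e]
          rw [mul_assoc]
          exact mul_le_mul_left inf_le_left _
        · calc R * (K g * 𝒜 h)
              ≤ (𝒜 p.1 * K p.2 * 𝒜 ((p.1 * p.2)⁻¹ * s)) * (𝒜 g * 𝒜 h) :=
                mul_le_mul' (inf_le_right.trans (iInf₂_le p hpV)) (mul_le_mul_left (hK g) _)
            _ = 𝒜 p.1 * K p.2 * (𝒜 ((p.1 * p.2)⁻¹ * s) * 𝒜 g * 𝒜 h) := by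
                simp only [mul_assoc]
            _ ≤ 𝒜 p.1 * K p.2 * 𝒜 ((p.1 * p.2)⁻¹ * (s * g * h)) := by
                refine mul_le_mul_right ((mul_le_mul_left (hmul _ _) _).trans
                  ((hmul _ _).trans (le_of_eq ?_))) _
                congr 1
                group

variable [Fintype Γ]

theorem pow_ideal_le (hmul : ∀ g h, 𝒜 g * 𝒜 h ≤ 𝒜 (g * h)) (h1 : (1 : A) ∈ 𝒜 1)
    (htop : ⨆ g, 𝒜 g = ⊤) {K : Γ → Submodule F A} (hK : ∀ g, K g ≤ 𝒜 g)
    {J : Submodule F A} (hJl : ⊤ * J ≤ J) (hJr : J * ⊤ ≤ J)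
    (hKJ : ∀ g, K g * 𝒜 g⁻¹ * K g ≤ J) {n : ℕ} (hn : Fintype.card Γ ≤ n) :
    (⊤ * (⨆ g, K g) * ⊤) ^ (n ^ 2 + 1) ≤ J := by
  refine (le_mul_top _).trans ?_
  rw [pow_top_mul_mul_top]
  refine (mul_le_mul_right (pow_le_sup_iSup hmul h1 htop hK hJl hJr hKJ _) _).trans ?_
  -- There are at most `n ^ 2` pairs, so no `V` has `n ^ 2 + 1` elements and only `J` survives.
  refine le_trans (mul_le_mul_right (sup_le le_rfl ?_) _) hJl
  simp only [iSup_le_iff]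
  intro V hV
  have h2 : V.card ≤ Fintype.card (Γ × Γ) := Finset.card_le_univ V
  rw [Fintype.card_prod] at h2
  have := Nat.mul_le_mul hn hn
  exact absurd hV (by nlinarith)

/-- Repeated doubling: `pow_ideal_le`, with `I ^ (2 ^ j)` in degree 1 and zero elsewhere, shows that
each further power `n ^ 2 + 1` doubles the exponent of `I`. After `d` doublings the exponent is `2 ^
d ≥ d`. -/
theorem top_mul_mul_top_pow_eq_bot (hmul : ∀ g h, 𝒜 g * 𝒜 h ≤ 𝒜 (g * h)) (h1 : (1 : A) ∈ 𝒜 1)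
    (htop : ⨆ g, 𝒜 g = ⊤) {I : Submodule F A} (hI : I ≤ 𝒜 1) (hIr : I * 𝒜 1 ≤ I)
    {n : ℕ} (hn : Fintype.card Γ ≤ n) {d : ℕ} (hd : I ^ d = ⊥) :
    (⊤ * I * ⊤) ^ ((n ^ 2 + 1) ^ d) = ⊥ := by
  classical
  have htt : (⊤ : Submodule F A) * ⊤ = ⊤ := top_mul_top_eq
  have hpow1 : ∀ k, I ^ (k + 1) * 𝒜 1 ≤ I ^ (k + 1) := fun k => by
    rw [pow_succ, mul_assoc]; exact mul_le_mul_right hIr _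
  have hpow2 : ∀ k, I ^ (k + 1) ≤ 𝒜 1 := fun k => by
    induction k with
    | zero => simpa using hI
    | succ k ih =>
      rw [pow_succ]
      exact (mul_le_mul' ih hI).trans ((hmul 1 1).trans (by rw [one_mul]))
  have key : ∀ j, (⊤ * I * ⊤) ^ ((n ^ 2 + 1) ^ j) ≤ ⊤ * I ^ (2 ^ j) * ⊤ := by
    intro j
    induction j with
    | zero => simp
    | succ j ih =>
      rw [pow_succ, pow_mul]
      refine (pow_le_pow_left' ih _).trans ?_
      -- A positive exponent is needed: `I ^ 0` is the span of `1` and need not be stable under `𝒜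
      -- 1`.
      obtain ⟨k, hk⟩ : ∃ k, 2 ^ j = k + 1 := ⟨2 ^ j - 1, by have := Nat.two_pow_pos j; omega⟩
      have := pow_ideal_le (𝒜 := 𝒜) hmul h1 htop
        (K := fun g => if g = 1 then I ^ (2 ^ j) else ⊥)
        (J := ⊤ * I ^ (2 ^ (j + 1)) * ⊤) ?_ ?_ ?_ ?_ hn
      · refine (pow_le_pow_left' (mul_le_mul_left (mul_le_mul_right ?_ _) _) _).trans this
        exact le_iSup_of_le 1 (by simp)
      · intro g
        by_cases hg : g = 1
        · subst hg; simpa [hk] using hpow2 k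
        · simp [hg]
      · simp only [← mul_assoc, htt, le_refl]
      · simp only [mul_assoc, htt, le_refl]
      · intro g
        by_cases hg : g = 1
        · subst hg
          simp only [if_true, inv_one]
          rw [pow_succ 2 j, mul_two, pow_add, hk]
          calc _ ≤ I ^ (k + 1) * I ^ (k + 1) := mul_le_mul_left (hpow1 k) _
            _ ≤ _ := (le_mul_top _).trans (mul_le_mul_left (le_top_mul _) _)
        · simp [hg]
  have h2 : I ^ (2 ^ d) = ⊥ := by
    rw [← Nat.sub_add_cancel (Nat.lt_two_pow_self (n := d)).le, pow_add, hd, Submodule.mul_bot]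
  simpa [h2] using key d

/-- Finitely many right factors suffice to generate `P * Q` modulo a subspace `I` of finite
codimension. -/
theorem exists_right_factors {P Q I W : Submodule F A} [Module.Finite F W] {m : ℕ}
    (hm : Module.finrank F W ≤ m) (hPQ : P * Q ≤ I ⊔ W) :
    ∃ u : Fin m → A, (∀ i, u i ∈ Q) ∧ P * Q ≤ I ⊔ ⨆ i, P * Submodule.span F {u i} := by
  classical
  have hfin : Module.Finite F (W.map I.mkQ) := inferInstance
  set T : Set (A ⧸ I) := {z | ∃ v ∈ P, ∃ u ∈ Q, z = I.mkQ (v * u)} with hT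
  -- A basis of the image of `P * Q` modulo `I` is chosen among the products themselves; it has at
  -- most `m` elements, and only their right factors are kept.
  obtain ⟨b, hbT, hspan, hli⟩ := exists_linearIndependent F T
  have hbW : ∀ z ∈ b, z ∈ W.map I.mkQ := by
    intro z hz
    obtain ⟨v, hv, u, hu, rfl⟩ := hbT hz
    have := Submodule.mem_map_of_mem (f := I.mkQ) (hPQ (Submodule.mul_mem_mul hv hu))
    simpa [Submodule.map_sup] using this
  have hli' : LinearIndependent F (fun z : b => (⟨z, hbW z z.2⟩ : W.map I.mkQ)) :=
    LinearIndependent.of_comp (W.map I.mkQ).subtype hli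
  have hbfin : Finite b := hli'.finite
  have := Fintype.ofFinite b
  have hcard : Fintype.card b ≤ m :=
    hli'.fintype_card_le_finrank.trans ((Submodule.finrank_map_le _ _).trans hm)
  choose v hv u hu hz using fun z : b => hbT z.2
  let e := Fintype.equivFin b
  -- Zeros pad the family to exactly `m` entries.
  refine ⟨fun i => if h : i.1 < Fintype.card b then u (e.symm ⟨i, h⟩) else 0, ?_, ?_⟩
  · intro i
    dsimp only
    split_ifs with h
    · exact hu _
    · exact Q.zero_mem
  · set X := ⨆ i : Fin m, P * Submodule.span F
      {(if h : i.1 < Fintype.card b then u (e.symm ⟨i, h⟩) else 0 : A)} with hX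
    have hmem : ∀ z : b, v z * u z ∈ X := by
      intro z
      have hlt : (e z).1 < Fintype.card b := (e z).2
      refine (le_iSup (fun i : Fin m => P * Submodule.span F
        {(if h : i.1 < Fintype.card b then u (e.symm ⟨i, h⟩) else 0 : A)})
        ⟨e z, hlt.trans_le hcard⟩) (Submodule.mul_mem_mul (hv z) ?_)
      simp only [hlt, dif_pos, Fin.eta, Equiv.symm_apply_apply]
      exact Submodule.mem_span_singleton_self _
    have hsX : Submodule.span F T ≤ X.map I.mkQ := by
      rw [← hspan, Submodule.span_le]
      intro z hzb
      exact ⟨_, hmem ⟨z, hzb⟩, (hz ⟨z, hzb⟩).symm⟩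
    rw [Submodule.mul_le]
    intro p hp q hq
    obtain ⟨x, hx, hxe⟩ := hsX (Submodule.subset_span ⟨p, hp, q, hq, rfl⟩)
    have hsub : p * q - x ∈ I := by
      rw [← Submodule.Quotient.mk_eq_zero, Submodule.Quotient.mk_sub, sub_eq_zero]
      exact hxe.symm
    have := Submodule.add_mem_sup hsub hx
    simpa using this

/-- An algebra graded by a finite group of order at most `n` whose identity component has a
nilpotent ideal of finite codimension has a nilpotent ideal of finite codimension. -/
theorem exists_nilpotent_ideal_of_graded (hmul : ∀ g h, 𝒜 g * 𝒜 h ≤ 𝒜 (g * h))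
    (h1 : (1 : A) ∈ 𝒜 1) (htop : ⨆ g, 𝒜 g = ⊤) {I : Submodule F A} (hI : I ≤ 𝒜 1)
    (hIr : I * 𝒜 1 ≤ I) {n : ℕ} (hn : Fintype.card Γ ≤ n)
    {d : ℕ} (hd : I ^ d = ⊥) {W : Submodule F A} [Module.Finite F W] {m : ℕ}
    (hm : Module.finrank F W ≤ m) (hW : 𝒜 1 ≤ I ⊔ W) :
    ∃ H : Submodule F A, ⊤ * H ≤ H ∧ H * ⊤ ≤ H ∧ H ^ ((n ^ 2 + 1) ^ (d + 1)) = ⊥ ∧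
      CodimLE H (n * m ^ 2) := by
  classical
  have htt : (⊤ : Submodule F A) * ⊤ = ⊤ := top_mul_top_eq
  have hEW : ∀ g, 𝒜 g * 𝒜 g⁻¹ ≤ I ⊔ W := fun g =>
    ((hmul g g⁻¹).trans (by rw [mul_inv_cancel])).trans hW
  choose u hu hE using fun g => exists_right_factors hm (hEW g)
  let K : Γ → Submodule F A := fun g =>
    if g = 1 then I else 𝒜 g ⊓ ⨅ i, I.comap (LinearMap.mulLeft F (u g i))
  have hK : ∀ g, K g ≤ 𝒜 g := fun g => by
    by_cases hg : g = 1
    · subst hg; simpa [K] using hI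
    · simp [K, hg]
  have hI1 : CodimLE (I.comap (𝒜 1).subtype) m := by
    have hmem : ∀ x ∈ 𝒜 1, I.mkQ x ∈ W.map I.mkQ := fun x hx => by
      simpa [Submodule.map_sup] using Submodule.mem_map_of_mem (f := I.mkQ) (hW hx)
    refine CodimLE.of_ker_le (I.mkQ.restrict hmem) (fun x hx => ?_)
      ((Submodule.finrank_map_le _ _).trans hm)
    have := congrArg Subtype.val (LinearMap.mem_ker.1 hx)
    simpa using this
  have hKc : ∀ g, CodimLE ((K g).comap (𝒜 g).subtype) (m ^ 2) := by
    intro g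
    by_cases hg : g = 1
    · subst hg
      exact hI1.mono (by simp [K]) (by nlinarith [Nat.le_mul_self m])
    -- Each of the `m` conditions `u g i * x ∈ I` costs at most `m` dimensions, whence `m ^ 2`.
    · have hmem : ∀ i, ∀ x ∈ 𝒜 g, u g i * x ∈ 𝒜 1 := fun i x hx => by
        have := hmul _ _ (Submodule.mul_mem_mul (hu g i) hx)
        rwa [inv_mul_cancel] at this
      let L : Fin m → (𝒜 g →ₗ[F] 𝒜 1) := fun i =>
        ((LinearMap.mulLeft F (u g i)).restrict (hmem i))
      have := CodimLE.iInf (fun i => hI1.comap (L i))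
      refine this.mono ?_ (by simp [sq])
      intro x hx
      simp only [Submodule.mem_iInf, Submodule.mem_comap] at hx
      simp only [K, hg, if_false, Submodule.mem_comap, Submodule.mem_inf, Submodule.mem_iInf]
      exact ⟨x.2, hx⟩
  set J : Submodule F A := ⊤ * I * ⊤ with hJ
  have hJl : ⊤ * J ≤ J := by simp only [hJ, ← mul_assoc, htt, le_refl]
  have hJr : J * ⊤ ≤ J := by simp only [hJ, mul_assoc, htt, le_refl]
  have hIJ : I ≤ J := (le_mul_top _).trans (mul_le_mul_left (le_top_mul _) _)
  have hKJ : ∀ g, K g * 𝒜 g⁻¹ * K g ≤ J := by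
    intro g
    by_cases hg : g = 1
    · subst hg
      calc _ ≤ K 1 * ⊤ * ⊤ := mul_le_mul' (mul_le_mul_right le_top _) le_top
        _ ≤ J * ⊤ * ⊤ := by
          refine mul_le_mul_left (mul_le_mul_left ?_ _) _
          simpa [K] using hIJ
        _ ≤ J := (mul_le_mul_left hJr _).trans hJr
    · have hKI : ∀ i, Submodule.span F {u g i} * K g ≤ I := by
        intro i
        rw [Submodule.mul_le]
        intro y hy x hx
        obtain ⟨c, rfl⟩ := Submodule.mem_span_singleton.1 hy
        simp only [K, hg, if_false, Submodule.mem_inf, Submodule.mem_iInf,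
          Submodule.mem_comap] at hx
        rw [smul_mul_assoc]
        exact I.smul_mem c (hx.2 i)
      calc _ ≤ 𝒜 g * 𝒜 g⁻¹ * K g := mul_le_mul_left (mul_le_mul_left (hK g) _) _
        _ ≤ (I ⊔ ⨆ i, 𝒜 g * Submodule.span F {u g i}) * K g := mul_le_mul_left (hE g) _
        _ ≤ J := by
          rw [Submodule.sup_mul, Submodule.iSup_mul]
          refine sup_le ((mul_le_mul' hIJ le_top).trans hJr) (iSup_le fun i => ?_)
          rw [mul_assoc]
          exact (mul_le_mul' le_top ((hKI i).trans hIJ)).trans hJl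
  refine ⟨⊤ * (⨆ g, K g) * ⊤, ?_, ?_, ?_, ?_⟩
  · simp only [← mul_assoc, htt, le_refl]
  · simp only [mul_assoc, htt, le_refl]
  -- The power `n ^ 2 + 1` of the ideal lies in `J`, whose power `(n ^ 2 + 1) ^ d` vanishes.
  · rw [pow_succ', pow_mul, eq_bot_iff,
      ← top_mul_mul_top_pow_eq_bot hmul h1 htop hI hIr hn hd]
    exact pow_le_pow_left' (pow_ideal_le hmul h1 htop hK hJl hJr hKJ hn) _
  · refine (CodimLE.of_iSup_eq_top htop (k := m ^ 2) fun g => (hKc g).mono ?_ le_rfl).mono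
      le_rfl (Nat.mul_le_mul_right _ hn)
    exact Submodule.comap_mono ((le_iSup K g).trans
      ((le_mul_top _).trans (mul_le_mul_left (le_top_mul _) _)))

end Graded

/-! ### Eigenspace grading of an automorphism of finite order. -/

section Eigenspaces

variable {K B : Type*} [Field K] [Ring B] [Algebra K B]

/-- The eigenspace of an algebra endomorphism. -/
def eigen (τ : B →ₐ[K] B) (c : K) : Submodule K B where
  carrier := {x | τ x = c • x}
  add_mem' := fun {x y} hx hy => by
    simp only [Set.mem_ofPred_eq] at *
    rw [map_add, hx, hy, smul_add]
  zero_mem' := by simp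
  smul_mem' := fun r x hx => by
    simp only [Set.mem_ofPred_eq] at *
    rw [map_smul, hx, smul_comm]

theorem mem_eigen {τ : B →ₐ[K] B} {c : K} {x : B} : x ∈ eigen τ c ↔ τ x = c • x := Iff.rfl

theorem eigen_mul_le (τ : B →ₐ[K] B) (c c' : K) :
    eigen τ c * eigen τ c' ≤ eigen τ (c * c') := by
  rw [Submodule.mul_le]
  intro x hx y hy
  rw [mem_eigen] at *
  rw [map_mul, hx, hy, smul_mul_smul_comm]

/-- Applying `τ` shifts the summation index and pulls out a factor `c`; since `τ ^ n = 1` and `c ^ n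
= 1`, the shift is cyclic. -/
theorem sum_mem_eigen {τ : B →ₐ[K] B} {n : ℕ} (hτ : τ ^ n = 1) {c : K} (hc : c ^ n = 1)
    (hc0 : c ≠ 0) (x : B) :
    ∑ j ∈ Finset.range n, (c⁻¹) ^ j • (τ ^ j) x ∈ eigen τ c := by
  rw [mem_eigen, map_sum, Finset.smul_sum]
  have h1 : ∀ j, τ ((c⁻¹) ^ j • (τ ^ j) x) = c • ((c⁻¹) ^ (j + 1) • (τ ^ (j + 1)) x) := by
    intro j
    rw [map_smul, smul_smul, pow_succ' c⁻¹, ← mul_assoc, mul_inv_cancel₀ hc0, one_mul,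
      pow_succ' τ]
    rfl
  simp only [h1]
  rw [← Finset.smul_sum, ← Finset.smul_sum]
  congr 1
  have h2 := Finset.sum_range_succ (fun j => (c⁻¹) ^ j • (τ ^ j) x) n
  rw [Finset.sum_range_succ'] at h2
  simpa [hτ, hc, inv_pow] using h2

/-- Fourier inversion: summing the eigenprojections of `x` over all powers of `ω` gives `n • x`.
Directness of the sum is never required. -/
theorem iSup_eigen_eq_top {τ : B →ₐ[K] B} {n : ℕ} (hτ : τ ^ n = 1) (hn : (n : K) ≠ 0)
    {ω : K} (hω : IsPrimitiveRoot ω n) :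
    ⨆ χ : rootsOfUnity n K, eigen τ ((χ : Kˣ) : K) = ⊤ := by
  have hn0 : n ≠ 0 := by rintro rfl; simp at hn
  have hω0 : ω ≠ 0 := hω.ne_zero hn0
  rw [eq_top_iff]
  intro x _
  set T := ⨆ χ : rootsOfUnity n K, eigen τ ((χ : Kˣ) : K) with hT
  have key : (n : K) • x =
      ∑ i ∈ Finset.range n, ∑ j ∈ Finset.range n, ((ω ^ i)⁻¹) ^ j • (τ ^ j) x := by
    rw [Finset.sum_comm]
    rw [Finset.sum_eq_single_of_mem 0 (Finset.mem_range.2 (Nat.pos_of_ne_zero hn0))]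
    · simp [Nat.cast_smul_eq_nsmul]
    · intro j hj hj0
      rw [← Finset.sum_smul]
      have hne : (ω ^ j)⁻¹ ≠ 1 := by
        rw [Ne, inv_eq_one]
        exact hω.pow_ne_one_of_pos_of_lt hj0 (Finset.mem_range.1 hj)
      have hg : ∑ i ∈ Finset.range n, ((ω ^ j)⁻¹) ^ i = 0 := by
        have h := mul_neg_geom_sum ((ω ^ j)⁻¹) n
        rw [inv_pow, ← pow_mul, mul_comm j n, pow_mul, hω.pow_eq_one, one_pow, inv_one,
          sub_self] at h
        exact (mul_eq_zero.1 h).resolve_left (sub_ne_zero.2 hne.symm)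
      have : ∀ i, ((ω ^ i)⁻¹) ^ j = ((ω ^ j)⁻¹) ^ i := fun i => by
        rw [inv_pow, inv_pow, ← pow_mul, ← pow_mul, mul_comm]
      simp only [this, hg, zero_smul]
  have hmem : (n : K) • x ∈ T := by
    rw [key]
    refine Submodule.sum_mem _ fun i _ => ?_
    have hi : (ω ^ i) ^ n = 1 := by rw [← pow_mul, mul_comm, pow_mul, hω.pow_eq_one, one_pow]
    have hi0 : ω ^ i ≠ 0 := pow_ne_zero _ hω0
    have hu : Units.mk0 (ω ^ i) hi0 ∈ rootsOfUnity n K := by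
      rw [mem_rootsOfUnity']
      exact hi
    exact le_iSup (fun χ : rootsOfUnity n K => eigen τ ((χ : Kˣ) : K)) ⟨_, hu⟩
      (sum_mem_eigen hτ hi hi0 x)
  simpa [smul_smul, inv_mul_cancel₀ hn] using T.smul_mem (n : K)⁻¹ hmem

theorem exists_nilpotent_ideal_of_primitiveRoot {τ : B →ₐ[K] B} {n : ℕ} (hτ : τ ^ n = 1)
    (hn : (n : K) ≠ 0) {ω : K} (hω : IsPrimitiveRoot ω n) {I : Submodule K B}
    (hI : I ≤ eigen τ 1) (hIr : I * eigen τ 1 ≤ I) {d : ℕ} (hd : I ^ d = ⊥)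
    {W : Submodule K B} [Module.Finite K W] {m : ℕ} (hm : Module.finrank K W ≤ m)
    (hW : eigen τ 1 ≤ I ⊔ W) :
    ∃ H : Submodule K B, ⊤ * H ≤ H ∧ H * ⊤ ≤ H ∧ H ^ ((n ^ 2 + 1) ^ (d + 1)) = ⊥ ∧
      CodimLE H (n * m ^ 2) := by
  have : NeZero n := ⟨by rintro rfl; simp at hn⟩
  have := Fintype.ofFinite (rootsOfUnity n K)
  have hcard : Fintype.card (rootsOfUnity n K) ≤ n := by
    rw [← Nat.card_eq_fintype_card]
    exact card_rootsOfUnity K n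
  refine exists_nilpotent_ideal_of_graded (Γ := rootsOfUnity n K)
    (𝒜 := fun χ => eigen τ ((χ : Kˣ) : K)) (fun χ ψ => ?_) ?_ (iSup_eigen_eq_top hτ hn hω)
    (I := I) ?_ ?_ hcard hd hm ?_
  · simpa using eigen_mul_le τ ((χ : Kˣ) : K) ((ψ : Kˣ) : K)
  · simp [mem_eigen]
  all_goals simpa

end Eigenspaces

/-! ### Extension of scalars and contraction back. -/

section BaseChange

open scoped TensorProduct

variable {F A : Type*} [Field F] [Ring A] [Algebra F A] (K : Type*) [Field K] [Algebra F K]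

theorem baseChange_mul_le (P Q : Submodule F A) :
    P.baseChange K * Q.baseChange K ≤ (P * Q).baseChange K := by
  rw [Submodule.baseChange_eq_span, Submodule.baseChange_eq_span, Submodule.span_mul_span,
    Submodule.span_le]
  rintro _ ⟨_, ⟨p, hp, rfl⟩, _, ⟨q, hq, rfl⟩, rfl⟩
  simpa using Submodule.tmul_mem_baseChange_of_mem (1 : K) (Submodule.mul_mem_mul hp hq)

theorem baseChange_pow_le (P : Submodule F A) (k : ℕ) :
    P.baseChange K ^ k ≤ (P ^ k).baseChange K := by
  induction k with
  | zero =>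
    rw [pow_zero, pow_zero, Submodule.one_le]
    exact Submodule.tmul_mem_baseChange_of_mem (1 : K) (Submodule.one_le.1 le_rfl)
  | succ k ih =>
    rw [pow_succ, pow_succ]
    exact (mul_le_mul_left ih _).trans (baseChange_mul_le K _ _)

theorem baseChange_sup_le (P Q : Submodule F A) :
    (P ⊔ Q).baseChange K ≤ P.baseChange K ⊔ Q.baseChange K := by
  rw [Submodule.baseChange_eq_span, Submodule.span_le]
  rintro _ ⟨x, hx, rfl⟩
  obtain ⟨p, hp, q, hq, rfl⟩ := Submodule.mem_sup.1 hx
  rw [map_add]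
  exact Submodule.add_mem_sup (Submodule.tmul_mem_baseChange_of_mem (1 : K) hp)
    (Submodule.tmul_mem_baseChange_of_mem (1 : K) hq)

theorem finite_baseChange (W : Submodule F A) [Module.Finite F W] :
    Module.Finite K (W.baseChange K) :=
  Module.Finite.of_surjective _ (W.toBaseChange_surjective K)

theorem finrank_baseChange_le (W : Submodule F A) [Module.Finite F W] :
    Module.finrank K (W.baseChange K) ≤ Module.finrank F W :=
  (LinearMap.finrank_le_finrank_of_surjective (W.toBaseChange_surjective K)).trans
    Module.finrank_baseChange.le

theorem comap_includeRight_pow_eq_bot {H : Submodule K (K ⊗[F] A)} {k : ℕ} (hH : H ^ k = ⊥) :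
    ((H.restrictScalars F).comap
      (Algebra.TensorProduct.includeRight : A →ₐ[F] K ⊗[F] A).toLinearMap) ^ k = ⊥ := by
  set ι := (Algebra.TensorProduct.includeRight : A →ₐ[F] K ⊗[F] A)
  set H' := (H.restrictScalars F).comap ι.toLinearMap with hH'
  have key : ∀ j, H' ^ j ≤ ((H ^ j).restrictScalars F).comap ι.toLinearMap := by
    intro j
    induction j with
    | zero =>
      rw [pow_zero, pow_zero, Submodule.one_le]
      simpa using Submodule.one_le.1 (le_refl (1 : Submodule K (K ⊗[F] A)))
    | succ j ih =>
      rw [pow_succ, pow_succ, Submodule.mul_le]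
      intro x hx y hy
      simp only [Submodule.mem_comap, AlgHom.toLinearMap_apply, map_mul,
        Submodule.restrictScalars_mem]
      exact Submodule.mul_mem_mul (ih hx) hy
  rw [eq_bot_iff]
  intro x hx
  have h := key k hx
  rw [hH] at h
  have hinj : Function.Injective ι :=
    Algebra.TensorProduct.includeRight_injective (algebraMap F K).injective
  exact hinj (by simpa using h)

/-- The quotient of `A` by the contraction embeds over `F` in `(K ⊗ A) / H`, whose `F`-dimension is
`[K : F]` times its `K`-dimension. -/
theorem CodimLE.comap_includeRight [Module.Finite F K] {H : Submodule K (K ⊗[F] A)} {k r : ℕ}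
    (hH : CodimLE H k) (hr : Module.finrank F K ≤ r) :
    CodimLE ((H.restrictScalars F).comap
      (Algebra.TensorProduct.includeRight : A →ₐ[F] K ⊗[F] A).toLinearMap) (r * k) := by
  have := hH.1
  have : Module.Finite F ((K ⊗[F] A) ⧸ H) := Module.Finite.trans K _
  refine CodimLE.of_ker_le ((H.mkQ.restrictScalars F) ∘ₗ
    (Algebra.TensorProduct.includeRight : A →ₐ[F] K ⊗[F] A).toLinearMap) ?_ ?_
  · intro x hx
    simpa using hx
  · rw [← Module.finrank_mul_finrank F K]
    exact Nat.mul_le_mul hr hH.2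

end BaseChange

/-! ### Automorphisms of finite order over an arbitrary field. -/

section Cyclic

open scoped TensorProduct

/-- If `n` is invertible in `F`, then some extension of `F` of degree at most `n` has a primitive
`n`-th root of unity. -/
theorem exists_primitiveRoot_extension.{u} (F : Type u) [Field F] {n : ℕ} (hn : (n : F) ≠ 0) :
    ∃ (K : Type u) (_ : Field K) (_ : Algebra F K) (ω : K), IsPrimitiveRoot ω n ∧
      Module.Finite F K ∧ Module.finrank F K ≤ n := by
  have : NeZero (n : F) := ⟨hn⟩
  have : NeZero n := ⟨by rintro rfl; simp at hn⟩
  have hω := IsCyclotomicExtension.zeta_spec n F (CyclotomicField n F)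
  refine ⟨_, inferInstance, inferInstance, _, hω,
    IsCyclotomicExtension.finite_of_singleton n F _, ?_⟩
  rw [(hω.powerBasis F).finrank, IsPrimitiveRoot.powerBasis_dim]
  have hdvd : minpoly F (IsCyclotomicExtension.zeta n F (CyclotomicField n F)) ∣
      (Polynomial.X ^ n - 1 : Polynomial F) := by
    apply minpoly.dvd
    simp [hω.pow_eq_one]
  refine (Polynomial.natDegree_le_of_dvd hdvd ?_).trans ?_
  · exact Polynomial.X_pow_sub_C_ne_zero (NeZero.pos n) (1 : F)
  · exact (Polynomial.natDegree_X_pow_sub_C (r := (1 : F))).le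

variable {F A : Type*} [Field F] [Ring A] [Algebra F A]

/-- One factor `n` in the codimension comes from the grading, the other from contracting along an
extension of degree at most `n`. -/
theorem exists_nilpotent_ideal_of_pow_eq_one {σ : A →ₐ[F] A} {n : ℕ} (hσ : σ ^ n = 1)
    (hn : (n : F) ≠ 0) {I : Submodule F A} (hI : I ≤ eigen σ 1) (hIr : I * eigen σ 1 ≤ I)
    {d : ℕ} (hd : I ^ d = ⊥) {W : Submodule F A} [Module.Finite F W] {m : ℕ}
    (hm : Module.finrank F W ≤ m) (hW : eigen σ 1 ≤ I ⊔ W) :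
    ∃ H : Submodule F A, ⊤ * H ≤ H ∧ H * ⊤ ≤ H ∧ H ^ ((n ^ 2 + 1) ^ (d + 1)) = ⊥ ∧
      CodimLE H (n ^ 2 * m ^ 2) := by
  have : NeZero n := ⟨by rintro rfl; simp at hn⟩
  obtain ⟨K, _, _, ω, hω, _, hr⟩ := exists_primitiveRoot_extension F hn
  have hnK : (n : K) ≠ 0 := by
    intro h
    apply hn
    apply (algebraMap F K).injective
    simpa using h
  let τ : K ⊗[F] A →ₐ[K] K ⊗[F] A := Algebra.TensorProduct.map (AlgHom.id K K) σ
  have hτpow : ∀ j (k : K) (a : A), (τ ^ j) (k ⊗ₜ[F] a) = k ⊗ₜ[F] ((σ ^ j) a) := by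
    intro j
    induction j with
    | zero => simp
    | succ j ih =>
      intro k a
      rw [pow_succ, pow_succ, AlgHom.mul_apply, AlgHom.mul_apply]
      simp [τ, ih]
  have hτ : τ ^ n = 1 := by
    refine AlgHom.ext fun x => ?_
    induction x using TensorProduct.induction_on with
    | zero => simp
    | add x y hx hy => rw [map_add, map_add, hx, hy]
    | tmul k a => rw [hτpow, hσ]; simp
  -- The sum over the powers of `τ` maps pure tensors into the extended fixed points and multiplies
  -- a fixed `x` by the invertible scalar `n`.
  have hfix : eigen τ 1 ≤ (eigen σ 1).baseChange K := by
    have hsum : ∀ x, ∑ j ∈ Finset.range n, (τ ^ j) x ∈ (eigen σ 1).baseChange K := by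
      intro x
      induction x using TensorProduct.induction_on with
      | zero => simp
      | add x y hx hy =>
        simp only [map_add, Finset.sum_add_distrib]
        exact Submodule.add_mem _ hx hy
      | tmul k a =>
        simp only [hτpow, ← TensorProduct.tmul_sum]
        refine Submodule.tmul_mem_baseChange_of_mem k ?_
        simpa using sum_mem_eigen hσ (one_pow n) one_ne_zero a
    intro x hx
    have hx1 : τ x = x := by simpa using mem_eigen.1 hx
    have hxj : ∀ j, (τ ^ j) x = x := by
      intro j
      induction j with
      | zero => simp
      | succ j ih => rw [pow_succ, AlgHom.mul_apply, hx1, ih]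
    have h := Submodule.smul_mem _ (n : K)⁻¹ (hsum x)
    simp only [hxj, Finset.sum_const, Finset.card_range] at h
    rwa [← Nat.cast_smul_eq_nsmul K, smul_smul, inv_mul_cancel₀ hnK, one_smul] at h
  have hle : (I.baseChange K) ≤ eigen τ 1 := by
    rw [Submodule.baseChange_eq_span, Submodule.span_le]
    rintro _ ⟨x, hx, rfl⟩
    have := mem_eigen.1 (hI hx)
    simp only [one_smul] at this
    simp [mem_eigen, τ, this]
  have := finite_baseChange K W
  obtain ⟨H, hHl, hHr, hHn, hHc⟩ := exists_nilpotent_ideal_of_primitiveRoot hτ hnK hω hle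
    ((mul_le_mul_right hfix _).trans ((baseChange_mul_le K _ _).trans
      (Submodule.baseChange_mono K hIr)))
    (d := d) (by
      rw [eq_bot_iff]
      refine (baseChange_pow_le K I d).trans ?_
      rw [hd, Submodule.baseChange_bot])
    ((finrank_baseChange_le K W).trans hm)
    (hfix.trans ((Submodule.baseChange_mono K hW).trans (baseChange_sup_le K _ _)))
  refine ⟨_, ?_, ?_, comap_includeRight_pow_eq_bot K hHn,
    (hHc.comap_includeRight K hr).mono le_rfl (le_of_eq (by ring))⟩
  · rw [Submodule.mul_le]
    intro x _ y hy
    simp only [Submodule.mem_comap, AlgHom.toLinearMap_apply, map_mul,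
      Submodule.restrictScalars_mem]
    exact hHl (Submodule.mul_mem_mul Submodule.mem_top hy)
  · rw [Submodule.mul_le]
    intro x hx y _
    simp only [Submodule.mem_comap, AlgHom.toLinearMap_apply, map_mul,
      Submodule.restrictScalars_mem]
    exact hHr (Submodule.mul_mem_mul hx Submodule.mem_top)

end Cyclic

/-! ### Induction over finite soluble groups. -/

section Induction

/-- Bound for the nilpotency index of the ideal produced by a cyclic group of order at most `n`. -/
def indexBound (n d : ℕ) : ℕ := (n ^ 2 + 1) ^ (d + 1)

/-- Bound for the codimension of the ideal produced by a cyclic group of order at most `n`. -/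
def codimBound (n m : ℕ) : ℕ := n ^ 2 * m ^ 2

theorem le_indexBound {n : ℕ} (hn : 1 ≤ n) (d : ℕ) : d ≤ indexBound n d := by
  have h2 : 2 ≤ n ^ 2 + 1 := by nlinarith
  calc d ≤ 2 ^ (d + 1) := by have := Nat.lt_two_pow_self (n := d + 1); omega
    _ ≤ indexBound n d := Nat.pow_le_pow_left h2 _

theorem le_codimBound {n : ℕ} (hn : 1 ≤ n) (m : ℕ) : m ≤ codimBound n m :=
  calc m ≤ m ^ 2 := Nat.le_self_pow two_ne_zero m
    _ ≤ codimBound n m := Nat.le_mul_of_pos_left _ (by positivity)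

variable {F A G : Type*} [Field F] [Ring A] [Algebra F A] [Group G]

/-- The fixed points of an action on a unital algebra. -/
def fixedPts (ρ : G →* (A →ₐ[F] A)) : Subalgebra F A where
  carrier := {a | ∀ g, ρ g a = a}
  add_mem' := fun {a b} ha hb g => by rw [map_add, ha g, hb g]
  mul_mem' := fun {a b} ha hb g => by rw [map_mul, ha g, hb g]
  algebraMap_mem' := fun r g => (ρ g).commutes r

theorem mem_fixedPts {ρ : G →* (A →ₐ[F] A)} {a : A} : a ∈ fixedPts ρ ↔ ∀ g, ρ g a = a := Iff.rfl

/-- Every action of `G` on a unital algebra whose fixed points have a nilpotent (right) ideal of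
finite codimension has a nilpotent ideal whose index and codimension are bounded by the `k`-fold
iterates of `indexBound n` and `codimBound n`. -/
def AlmostNilpotentIn.{u, v, w} (n k : ℕ) (G : Type w) [Group G] : Prop :=
  ∀ (F : Type u) [Field F] (A : Type v) [Ring A] [Algebra F A] (ρ : G →* (A →ₐ[F] A)) (d m : ℕ)
    (I : Submodule F (fixedPts ρ)), (Nat.card G : F) ≠ 0 → I * ⊤ ≤ I → I ^ d = ⊥ → CodimLE I m →
    ∃ H : Submodule F A, ⊤ * H ≤ H ∧ H * ⊤ ≤ H ∧ H ^ ((indexBound n)^[k] d) = ⊥ ∧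
      CodimLE H ((codimBound n)^[k] m)

theorem pow_eq_bot_of_le {H : Submodule F A} {k l : ℕ} (hH : H ^ k = ⊥) (hkl : k ≤ l) :
    H ^ l = ⊥ :=
  pow_eq_zero_of_le hkl hH

universe u v w

theorem AlmostNilpotentIn.mono {n k l : ℕ} {G : Type w} [Group G]
    (h : AlmostNilpotentIn.{u, v, w} n k G) (hn : 1 ≤ n) (hkl : k ≤ l) :
    AlmostNilpotentIn.{u, v, w} n l G := by
  intro F _ A _ _ ρ d m I h1 h2 h3 h4
  obtain ⟨H, hl, hr, hd, hc⟩ := h F A ρ d m I h1 h2 h3 h4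
  exact ⟨H, hl, hr, pow_eq_bot_of_le hd
    (Function.monotone_iterate_of_id_le (fun d => le_indexBound hn d) hkl d),
    hc.mono le_rfl (Function.monotone_iterate_of_id_le (fun d => le_codimBound hn d) hkl m)⟩

theorem almostNilpotentIn_of_isCyclic {n : ℕ} {G : Type w} [Group G] [Finite G] [IsCyclic G]
    (hn : Nat.card G ≤ n) : AlmostNilpotentIn.{u, v, w} n 1 G := by
  intro F _ A _ _ ρ d m I h1 h2 h3 h4
  obtain ⟨g, hg⟩ := IsCyclic.exists_generator (α := G)
  have hσ : (ρ g) ^ Nat.card G = 1 := by rw [← map_pow, pow_card_eq_one', map_one]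
  have hfix : eigen (ρ g) 1 = Subalgebra.toSubmodule (fixedPts ρ) := by
    ext x
    rw [mem_eigen, one_smul, Subalgebra.mem_toSubmodule, mem_fixedPts]
    refine ⟨fun hx h => ?_, fun h => h g⟩
    obtain ⟨j, rfl⟩ := (mem_powers_iff_mem_zpowers).2 (hg h)
    induction j with
    | zero => simp
    | succ j ih =>
      simp only [pow_succ, map_mul, AlgHom.mul_apply, hx] at ih ⊢
      exact ih
  obtain ⟨W, hWf, hWm, hIW⟩ := h4.exists_sup_eq_top
  set v := (fixedPts ρ).val
  have hrange : (fixedPts ρ).val.toLinearMap.range = Subalgebra.toSubmodule (fixedPts ρ) := by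
    ext x; simp
  have hle : I.map v.toLinearMap ≤ eigen (ρ g) 1 := by
    rw [hfix, ← hrange]
    exact LinearMap.map_le_range
  have hmul : I.map v.toLinearMap * eigen (ρ g) 1 ≤ I.map v.toLinearMap := by
    rw [hfix, ← hrange, LinearMap.range_eq_map, ← Submodule.map_mul]
    exact Submodule.map_mono h2
  have hpow : I.map v.toLinearMap ^ d = ⊥ := by rw [← Submodule.map_pow, h3, Submodule.map_bot]
  have hW : eigen (ρ g) 1 ≤ I.map v.toLinearMap ⊔ W.map v.toLinearMap := by
    rw [hfix, ← hrange, LinearMap.range_eq_map, ← Submodule.map_sup, hIW]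
  obtain ⟨H, hl, hr, hd, hc⟩ := exists_nilpotent_ideal_of_pow_eq_one hσ h1 hle hmul hpow
    ((Submodule.finrank_map_le _ _).trans hWm) hW
  refine ⟨H, hl, hr, pow_eq_bot_of_le hd ?_, hc.mono le_rfl ?_⟩
  · exact Nat.pow_le_pow_left (by gcongr) _
  · exact Nat.mul_le_mul_right _ (by gcongr)

/-- The ideal obtained in `A^N` from the action of `G ⧸ N` serves as input for the action of `N` on
`A`; the bounds compose, so the iteration counts add. -/
theorem AlmostNilpotentIn.of_normal {n a b : ℕ} {G : Type w} [Group G] (N : Subgroup G) [N.Normal]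
    (hN : AlmostNilpotentIn.{u, v, w} n a N) (hQ : AlmostNilpotentIn.{u, v, w} n b (G ⧸ N)) :
    AlmostNilpotentIn.{u, v, w} n (a + b) G := by
  intro F _ A _ _ ρ d m I h1 h2 h3 h4
  set ρN : N →* (A →ₐ[F] A) := ρ.comp N.subtype
  have hfixN : ∀ x ∈ fixedPts ρN, ∀ g ∈ N, ρ g x = x := fun x hx g hg => hx ⟨g, hg⟩
  have hstab : ∀ (g : G), ∀ x ∈ fixedPts ρN, ρ g x ∈ fixedPts ρN := by
    intro g x hx ⟨k, hk⟩
    have hconj : g⁻¹ * k * g ∈ N := by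
      simpa using (inferInstance : N.Normal).conj_mem k hk g⁻¹
    have h := congrArg (ρ g) (hfixN x hx _ hconj)
    rw [← AlgHom.mul_apply, ← map_mul] at h
    have e : g * (g⁻¹ * k * g) = k * g := by group
    rw [e, map_mul, AlgHom.mul_apply] at h
    exact h
  -- Normality of `N` makes `A^N` stable under `G`; as `N` acts trivially there, the action descends
  -- to `G ⧸ N`.
  let ρ₁ : G →* (fixedPts ρN →ₐ[F] fixedPts ρN) :=
    { toFun := fun g => ((ρ g).comp (fixedPts ρN).val).codRestrict (fixedPts ρN)
        fun x => hstab g x x.2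
      map_one' := by ext x; simp
      map_mul' := fun g h => by ext x; simp; rfl }
  let ρQ : G ⧸ N →* (fixedPts ρN →ₐ[F] fixedPts ρN) := QuotientGroup.lift N ρ₁ fun g hg => by
    ext x
    exact hfixN x x.2 g hg
  have hmem1 : ∀ x : fixedPts ρN, x ∈ fixedPts ρQ → (x : A) ∈ fixedPts ρ := by
    intro x hx g
    exact congrArg Subtype.val (hx (g : G ⧸ N))
  let φ : fixedPts ρQ →ₐ[F] fixedPts ρ :=
    ((fixedPts ρN).val.comp (fixedPts ρQ).val).codRestrict (fixedPts ρ) fun x => hmem1 x x.2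
  have hφinj : Function.Injective φ := by
    intro x y h
    exact Subtype.ext (Subtype.ext (congrArg (Subtype.val : fixedPts ρ → A) h))
  have hcard : Nat.card G = Nat.card (G ⧸ N) * Nat.card N :=
    Subgroup.card_eq_card_quotient_mul_card_subgroup N
  rw [hcard, Nat.cast_mul] at h1
  have hpow : ∀ j, I.comap φ.toLinearMap ^ j ≤ (I ^ j).comap φ.toLinearMap := by
    intro j
    induction j with
    | zero =>
      rw [pow_zero, pow_zero, Submodule.one_le]
      simpa using Submodule.one_le.1 (le_refl (1 : Submodule F (fixedPts ρ)))
    | succ j ih =>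
      rw [pow_succ, pow_succ, Submodule.mul_le]
      intro x hx y hy
      simp only [Submodule.mem_comap, AlgHom.toLinearMap_apply, map_mul]
      exact Submodule.mul_mem_mul (ih hx) hy
  have hmul : I.comap φ.toLinearMap * ⊤ ≤ I.comap φ.toLinearMap := by
    rw [Submodule.mul_le]
    intro x hx y _
    simp only [Submodule.mem_comap, AlgHom.toLinearMap_apply, map_mul]
    exact h2 (Submodule.mul_mem_mul hx Submodule.mem_top)
  have hbot : I.comap φ.toLinearMap ^ d = ⊥ := by
    rw [eq_bot_iff]
    intro x hx
    have h := hpow d hx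
    rw [h3] at h
    exact hφinj (by simpa using h)
  obtain ⟨H₁, _, hr₁, hd₁, hc₁⟩ := hQ F (fixedPts ρN) ρQ d m (I.comap φ.toLinearMap)
    (left_ne_zero_of_mul h1) hmul hbot (h4.comap _)
  obtain ⟨H, hl, hr, hd, hc⟩ := hN F A ρN _ _ H₁ (right_ne_zero_of_mul h1) hr₁ hd₁ hc₁
  rw [← Function.iterate_add_apply] at hd hc
  exact ⟨H, hl, hr, hd, hc⟩

/-- If `G` is abelian, any nontrivial cyclic subgroup serves; otherwise the commutator subgroup
does, being proper by solubility. -/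
theorem exists_normal_ne_bot_ne_top {G : Type*} [Group G] [Group.IsSolvable G]
    (hG : ¬ IsCyclic G) : ∃ N : Subgroup G, N.Normal ∧ N ≠ ⊥ ∧ N ≠ ⊤ := by
  have : Nontrivial G := by
    by_contra h
    rw [not_nontrivial_iff_subsingleton] at h
    exact hG inferInstance
  by_cases hc : commutator G = ⊥
  · obtain ⟨g, hg⟩ := exists_ne (1 : G)
    have hcomm : ∀ a b : G, a * b = b * a := fun a b =>
      commutatorElement_eq_one_iff_mul_comm.1 (by
        have := Subgroup.commutator_mem_commutator (Subgroup.mem_top a) (Subgroup.mem_top b)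
        rwa [← commutator_def, hc, Subgroup.mem_bot] at this)
    refine ⟨Subgroup.zpowers g, ⟨fun x hx h => ?_⟩, ?_, ?_⟩
    · rwa [hcomm h x, mul_inv_cancel_right]
    · simpa using hg
    · intro h
      exact hG ⟨g, fun x => by
        have hx := Subgroup.mem_top x
        rwa [← h] at hx⟩
  · exact ⟨commutator G, inferInstance, hc,
      (Group.IsSolvable.commutator_lt_top_of_nontrivial G).ne⟩

/-- As many iterations as the group order suffice, since `a + b ≤ a * b` for `a, b ≥ 2`. The bound
`n` stays fixed while the order `r` decreases. -/
theorem almostNilpotentIn_of_isSolvable {n : ℕ} (hn : 1 ≤ n) (r : ℕ) :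
    ∀ (G : Type w) [Group G] [Finite G] [Group.IsSolvable G], Nat.card G = r → r ≤ n →
      AlmostNilpotentIn.{u, v, w} n r G := by
  induction r using Nat.strong_induction_on with
  | _ r ih =>
    intro G _ _ _ hr hrn
    by_cases hG : IsCyclic G
    · exact (almostNilpotentIn_of_isCyclic (hr.trans_le hrn)).mono hn
        (hr ▸ Nat.card_pos)
    · obtain ⟨N, hNn, hNb, hNt⟩ := exists_normal_ne_bot_ne_top hG
      have hcard : Nat.card (G ⧸ N) * Nat.card N = r :=
        (Subgroup.card_eq_card_quotient_mul_card_subgroup N).symm.trans hr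
      have hN : 2 ≤ Nat.card N := N.one_lt_card_iff_ne_bot.2 hNb
      have hQ : 2 ≤ Nat.card (G ⧸ N) := by
        have h0 : 0 < Nat.card (G ⧸ N) := Nat.card_pos
        have h1 : Nat.card (G ⧸ N) ≠ 1 := fun h => hNt (Subgroup.index_eq_one.1 h)
        omega
      have hNr : Nat.card N < r := by nlinarith
      have hQr : Nat.card (G ⧸ N) < r := by nlinarith
      exact (AlmostNilpotentIn.of_normal N (ih _ hNr N rfl (by omega))
        (ih _ hQr (G ⧸ N) rfl (by omega))).mono hn (by nlinarith)

end Induction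

/-! ### Passage to the unitization. -/

section Unitization

variable {F A G : Type*} [Field F] [NonUnitalRing A] [Module F A] [IsScalarTower F A A]
  [SMulCommClass F A A] [Group G]

/-- The extension of a multiplicative linear map to the unitization. -/
def unitizationMap (φ : A →ₙₐ[F] A) : Unitization F A →ₐ[F] Unitization F A :=
  Unitization.lift ((Unitization.inrNonUnitalAlgHom F A).comp φ)

theorem fst_unitizationMap (φ : A →ₙₐ[F] A) (x : Unitization F A) :
    (unitizationMap φ x).fst = x.fst := by
  induction x with
  | inl_add_inr r a => simp [unitizationMap, Unitization.algebraMap_eq_inl]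

theorem snd_unitizationMap (φ : A →ₙₐ[F] A) (x : Unitization F A) :
    (unitizationMap φ x).snd = φ x.snd := by
  induction x with
  | inl_add_inr r a => simp [unitizationMap, Unitization.algebraMap_eq_inl]

/-- The action by algebra automorphisms on the unitization. -/
def unitizationAction (ρ : Representation F G A) (hρ : ActsByAutomorphisms ρ) :
    G →* (Unitization F A →ₐ[F] Unitization F A) where
  toFun g := unitizationMap
    { toFun := ρ g, map_smul' := map_smul _, map_zero' := map_zero _, map_add' := map_add _,
      map_mul' := hρ g }
  map_one' := by
    refine AlgHom.ext fun x => Unitization.ext ?_ ?_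
    · rw [fst_unitizationMap]; rfl
    · rw [snd_unitizationMap]; simp
  map_mul' g h := by
    refine AlgHom.ext fun x => Unitization.ext ?_ ?_
    · rw [AlgHom.mul_apply]
      simp only [fst_unitizationMap]
    · rw [AlgHom.mul_apply]
      simp [snd_unitizationMap]

theorem snd_unitizationAction (ρ : Representation F G A) (hρ : ActsByAutomorphisms ρ) (g : G)
    (x : Unitization F A) : (unitizationAction ρ hρ g x).snd = ρ g x.snd :=
  snd_unitizationMap _ x

/-- The projection of the fixed points of the unitization onto the fixed-point subalgebra. -/
def fixedSnd (ρ : Representation F G A) (hρ : ActsByAutomorphisms ρ) :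
    fixedPts (unitizationAction ρ hρ) →ₗ[F] fixedSubalgebra ρ hρ where
  toFun x := ⟨x.1.snd, fun g => by rw [← snd_unitizationAction ρ hρ, x.2 g]⟩
  map_add' _ _ := rfl
  map_smul' _ _ := rfl

/-- The image in the fixed points of the unitization of a subspace of the fixed-point
subalgebra. -/
def unitizationIdeal (ρ : Representation F G A) (hρ : ActsByAutomorphisms ρ)
    (I : Submodule F (fixedSubalgebra ρ hρ)) :
    Submodule F (fixedPts (unitizationAction ρ hρ)) where
  carrier := {x | x.1.fst = 0 ∧ fixedSnd ρ hρ x ∈ I}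
  add_mem' := fun {x y} hx hy => ⟨by simp [hx.1, hy.1], by
    rw [map_add]; exact I.add_mem hx.2 hy.2⟩
  zero_mem' := ⟨by simp, by rw [map_zero]; exact I.zero_mem⟩
  smul_mem' := fun c x hx => ⟨by simp [hx.1], by rw [map_smul]; exact I.smul_mem c hx.2⟩

variable {ρ : Representation F G A} {hρ : ActsByAutomorphisms ρ}
  {I : Submodule F (fixedSubalgebra ρ hρ)}

theorem fixedSnd_mul {x : fixedPts (unitizationAction ρ hρ)} (hx : x.1.fst = 0)
    (y : fixedPts (unitizationAction ρ hρ)) :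
    fixedSnd ρ hρ (x * y) = y.1.fst • fixedSnd ρ hρ x + fixedSnd ρ hρ x * fixedSnd ρ hρ y := by
  refine Subtype.ext ?_
  change (x.1 * y.1).snd = y.1.fst • x.1.snd + x.1.snd * y.1.snd
  rw [Unitization.snd_mul, hx, zero_smul, zero_add]

theorem unitizationIdeal_mul_top_le (hI : IsTwoSidedIdeal I) :
    unitizationIdeal ρ hρ I * ⊤ ≤ unitizationIdeal ρ hρ I := by
  rw [Submodule.mul_le]
  intro x hx y _
  refine ⟨by simp [hx.1], ?_⟩
  rw [fixedSnd_mul hx.1]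
  exact I.add_mem (I.smul_mem _ hx.2) (hI _ _ hx.2).2

theorem unitizationIdeal_pow_le (k : ℕ) :
    unitizationIdeal ρ hρ I ^ (k + 1) ≤ unitizationIdeal ρ hρ (subspacePow I k) := by
  induction k with
  | zero => simp [subspacePow]
  | succ k ih =>
    rw [pow_succ, Submodule.mul_le]
    intro x hx y hy
    have hx' := ih hx
    refine ⟨by simp [hx'.1], ?_⟩
    rw [fixedSnd_mul hx'.1, hy.1, zero_smul, zero_add]
    exact Submodule.subset_span ⟨_, hx'.2, _, hy.2, rfl⟩

theorem unitizationIdeal_pow_eq_bot {d : ℕ} (hI : IsNilpotentOfIndex I d) :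
    unitizationIdeal ρ hρ I ^ d = ⊥ := by
  obtain ⟨hd, hI⟩ := hI
  rw [eq_bot_iff, ← Nat.sub_add_cancel hd]
  refine (unitizationIdeal_pow_le _).trans ?_
  rw [hI]
  intro x hx
  exact Subtype.ext (Unitization.ext hx.1 (congrArg Subtype.val ((Submodule.mem_bot F).1 hx.2)))

/-- The additional dimension is the scalar component of the unitization. -/
theorem codimLE_unitizationIdeal {m : ℕ} (hI : HasCodimension I m) :
    CodimLE (unitizationIdeal ρ hρ I) (m + 1) := by
  have := hI.1
  refine CodimLE.of_ker_le (LinearMap.prod ((Unitization.fstHom F A).toLinearMap ∘ₗ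
    (fixedPts (unitizationAction ρ hρ)).val.toLinearMap) (I.mkQ ∘ₗ fixedSnd ρ hρ)) ?_ ?_
  · intro x hx
    obtain ⟨h1, h2⟩ := Prod.mk.inj (LinearMap.mem_ker.1 hx)
    exact ⟨h1, (Submodule.Quotient.mk_eq_zero I).1 h2⟩
  · rw [Module.finrank_prod, Module.finrank_self, hI.2, add_comm]

theorem subspacePow_comap_inrHom_le (H : Submodule F (Unitization F A)) (k : ℕ) :
    subspacePow (H.comap (Unitization.inrHom F F A)) k ≤
      (H ^ (k + 1)).comap (Unitization.inrHom F F A) := by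
  induction k with
  | zero => simp [subspacePow]
  | succ k ih =>
    refine Submodule.span_le.2 ?_
    rintro _ ⟨x, hx, y, hy, rfl⟩
    rw [pow_succ]
    simpa using Submodule.mul_mem_mul (ih hx) hy

end Unitization

end AlmostNilpotent

/-! ### The main theorem for algebras without unit. -/

theorem theorem1 :
    ∃ (f : ℕ → ℕ → ℕ) (c : ℕ → ℕ → ℕ → ℕ),
      ∀ (F : Type*) [Field F]
        (A : Type*) [NonUnitalRing A] [Module F A] [IsScalarTower F A A] [SMulCommClass F A A]
        (G : Type*) [Group G] [Finite G] [Group.IsSolvable G]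
        (ρ : Representation F G A) (hρ : AlmostNilpotent.ActsByAutomorphisms ρ)
        (n d m : ℕ),
        Nat.card G = n →
        ¬ ringChar F ∣ n →
        (∃ I : Submodule F (AlmostNilpotent.fixedSubalgebra ρ hρ),
          AlmostNilpotent.IsTwoSidedIdeal I ∧
          AlmostNilpotent.IsNilpotentOfIndex I d ∧
          AlmostNilpotent.HasCodimension I m) →
        ∃ H : Submodule F A,
          AlmostNilpotent.IsTwoSidedIdeal H ∧
          (∃ k : ℕ, k ≤ f n d ∧ AlmostNilpotent.IsNilpotentOfIndex H k) ∧
          (∃ t : ℕ, t ≤ c n d m ∧ AlmostNilpotent.HasCodimension H t) := by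
  -- The `+ 1` in the index guarantees that it is at least 1; the `m + 1` comes from the adjoined
  -- unit.
  refine ⟨fun n d => (AlmostNilpotent.indexBound n)^[n] d + 1,
    fun n _ m => (AlmostNilpotent.codimBound n)^[n] (m + 1), ?_⟩
  intro F _ A _ _ _ _ G _ _ _ ρ hρ n d m hn hchar ⟨I, hI, hd, hm⟩
  have hn1 : 1 ≤ n := hn ▸ Nat.card_pos
  have hn0 : (Nat.card G : F) ≠ 0 := by
    rw [hn]
    exact fun h => hchar ((ringChar.spec F n).1 h)
  obtain ⟨H, hl, hr, hH, hc⟩ := AlmostNilpotent.almostNilpotentIn_of_isSolvable hn1 n G hn le_rfl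
    F (Unitization F A) (AlmostNilpotent.unitizationAction ρ hρ) d (m + 1) _ hn0
    (AlmostNilpotent.unitizationIdeal_mul_top_le hI)
    (AlmostNilpotent.unitizationIdeal_pow_eq_bot hd) (AlmostNilpotent.codimLE_unitizationIdeal hm)
  refine ⟨H.comap (Unitization.inrHom F F A), fun b x hx => ⟨?_, ?_⟩,
    ⟨_, le_rfl, Nat.le_add_left 1 _, ?_⟩,
    ⟨_, (hc.comap (Unitization.inrHom F F A)).2, (hc.comap (Unitization.inrHom F F A)).1, rfl⟩⟩
  · simpa using hl (Submodule.mul_mem_mul (Submodule.mem_top (x := (b : Unitization F A))) hx)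
  · simpa using hr (Submodule.mul_mem_mul hx (Submodule.mem_top (x := (b : Unitization F A))))
  · rw [Nat.add_sub_cancel, eq_bot_iff]
    refine (AlmostNilpotent.subspacePow_comap_inrHom_le H _).trans ?_
    rw [AlmostNilpotent.pow_eq_bot_of_le hH (Nat.le_succ _)]
    intro x hx
    exact Unitization.inr_injective (R := F) (by simpa using hx)
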